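/- Let $(\mathcal X,d)$ be a compact metric space with at least two points, $D_{\mathcal X}>0$ its diameter, $\eta\in(0,D_{\mathcal X}]$, and $y_1,\dots,y_J$ distinct points of $\mathcal X$ whose closed balls of radius $\eta$ cover $\mathcal X$. Let $q>1$, with $q<\sqrt{1+\frac1{J-1}}$ if $J\ge 2$. Let $(x_n)_{n\in\mathbb N}$ be a dense sequence in $\mathcal X$ and $\beta:\mathbb N\to\{1,\dots,J\}$ a map with infinite fibres such that, for all $n$ and $j$, $$d(x_n,y_{\beta(n)})=\min_{i}d(x_n,y_i),\qquad \sum_{n\in\beta^{-1}(\{j\})}q^{-2n}=\frac1J\,\frac{q^2}{q^2-1}.$$ For $x\in\mathcal X$ and $u\in\mathbb R^J$ put $$\varphi(x)=\Big(\tfrac{\sqrt{q^2-1}}{q}\,\tfrac{d(x,x_n)}{q^n}\Big)_{n\in\mathbb N}\in\ell^2,\quad \hat\varphi(x)=\Big(\tfrac{d(x,y_j)}{\sqrt J}\Big)_{j=1}^J\in\mathbb R^J,\quad B(u)=\Big(\tfrac{\sqrt{J(q^2-1)}}{q}\,\tfrac{u_{\beta(n)}}{q^n}\Big)_{n\in\mathbb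 N}\in\ell^2,$$ and $W=\varphi(\mathcal X)\cup B(\hat\varphi(\mathcal X))$. Let $k_W:W^2\to\mathbb R$ be of one of the following two types. - *Taylor*: $k_W(u,v)=K(\langle u,v\rangle_{\ell^2})$ with $K(t)=\sum_{n\ge0}a_nt^n$, all $a_n>0$, the series converging absolutely on $I:=[-4D_{\mathcal X}^2,4D_{\mathcal X}^2]$. - *Radial*: $k_W(u,v)=K(\|u-v\|_{\ell^2}^2)$ with $K(t)=\int_0^{+\infty}e^{-st}\,d\mu(s)$, where $\mu$ is a non-zero finite Borel measure on $[0,+\infty)$ with $\operatorname{supp}(\mu)\ne\{0\}$; put $I:=[0,4D_{\mathcal X}^2]$. Let $H$ and $\hat H$ be the reproducing kernel Hilbert spaces on $\mathcal X$ of the kernels $$k(x,y)=k_W(\varphi(x),\varphi(y)),\qquad \hat k(x,y)=k_W(B\hat\varphi(x),B\hat\varphi(y)).$$ Let $\varepsilon>0$ and let $f:\mathcal X\to\mathbb R$ be continuous. Then $$h[\varepsilon,f]:=\operatorname*{argmin}_{h\in H:\ \|h-f\|_\infty\le\varepsilon}\|h\|_H^2$$ is well defined (there is exactly one minimiser). If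 moreover $K$ is differentiable on $I$ (one-sidedly at the endpoints) and $|K'|$ attains its maximum $C_{K'}:=\max_{t\in I}|K'(t)|$ there, then there exists $\hat h\in\hat H$ such that $$\|f-\hat h\|_\infty\le\varepsilon+\rho_0\,\|h[\varepsilon,f]\|_H,$$ where $\rho_0=\eta^{1/2}\sqrt{2D_{\mathcal X}C_{K'}}$ for a Taylor kernel and $\rho_0=\eta\sqrt{2C_{K'}}$ for a radial kernel. -/

import Mathlib

open MeasureTheory Set
open scoped NNReal InnerProductSpace

noncomputable section

/-- A (real, symmetric, positive-definite) kernel on a set `X`. -/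
structure PDKernel (X : Type*) where
  toFun : X → X → ℝ
  symm : ∀ x y, toFun x y = toFun y x
  nonneg : ∀ (n : ℕ) (x : Fin n → X) (a : Fin n → ℝ),
    0 ≤ ∑ i, ∑ j, a i * toFun (x i) (x j) * a j

namespace PDKernel

variable {X Y : Type*}

/-- The kernel `(x, x') ↦ k (g x) (g x')`. -/
def comp (k : PDKernel Y) (g : X → Y) : PDKernel X where
  toFun x x' := k.toFun (g x) (g x')
  symm _ _ := k.symm _ _
  nonneg n x a := k.nonneg n (fun i => g (x i)) a

/-- The kernel seen as a matrix of operators on the one-dimensional space `ℝ`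
(the format of the Mathlib construction of reproducing kernel Hilbert spaces). -/
def toMatrix (k : PDKernel X) : Matrix X X (ℝ →L[ℝ] ℝ) :=
  Matrix.of fun x y => k.toFun x y • ContinuousLinearMap.id ℝ ℝ

lemma toMatrix_apply (k : PDKernel X) (x y : X) (t : ℝ) :
    k.toMatrix x y t = k.toFun x y * t := by
  simp [toMatrix]

lemma sum_finset_nonneg (k : PDKernel X) (s : Finset X) (c : X → ℝ) :
    0 ≤ ∑ x ∈ s, ∑ y ∈ s, c x * k.toFun x y * c y := by
  have h := k.nonneg s.card (fun i => (s.equivFin.symm i : X)) (fun i => c (s.equivFin.symm i))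
  have e : ∀ F : X → ℝ, ∑ i, F (s.equivFin.symm i : X) = ∑ x ∈ s, F x := by
    intro F
    rw [← Finset.sum_coe_sort s F]
    exact Equiv.sum_comp s.equivFin.symm (fun x : s => F x)
  rw [← e (fun x => ∑ y ∈ s, c x * k.toFun x y * c y)]
  refine h.trans_eq (Finset.sum_congr rfl fun i _ => ?_)
  exact e (fun y => c (s.equivFin.symm i) * k.toFun (s.equivFin.symm i) y * c y)

instance factPosSemidef (k : PDKernel X) : Fact (k.toMatrix).PosSemidef := ⟨by
  have key := (RKHS.posSemidef_tfae (K := k.toMatrix)).out 0 2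
  refine key.mpr ⟨?_, fun c => ?_⟩
  · ext x y
    have h1 : star (ContinuousLinearMap.id ℝ ℝ) = ContinuousLinearMap.id ℝ ℝ :=
      star_one (ℝ →L[ℝ] ℝ)
    simp [toMatrix, Matrix.conjTranspose_apply, k.symm x y, h1]
  · simp only [Finsupp.sum, toMatrix_apply, RCLike.re_to_real]
    refine (k.sum_finset_nonneg c.support c).trans_eq ?_
    refine Finset.sum_congr rfl fun x _ => Finset.sum_congr rfl fun y _ => ?_
    rw [k.symm x y]
    simp
    ring⟩

/-- The reproducing kernel Hilbert space of the kernel `k`; its elements coerce to functions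
`X → ℝ`. -/
abbrev rkhs (k : PDKernel X) : Type _ := RKHS.OfKernel k.toMatrix

/-- `h` is a minimiser of `‖h‖²` among all elements of the reproducing kernel Hilbert space of `k`
whose uniform distance to `f` is at most `ε`. -/
def IsMinNormApprox (k : PDKernel X) (f : X → ℝ) (ε : ℝ) (h : k.rkhs) : Prop :=
  IsMinOn (fun g : k.rkhs => ‖g‖ ^ 2) {g : k.rkhs | ∀ x, |g x - f x| ≤ ε} h ∧
    ∀ x, |h x - f x| ≤ ε

end PDKernel

/-- The Hilbert space of square-summable real sequences. -/
abbrev SeqL2 : Type := lp (fun _ : ℕ => ℝ) 2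

section PositiveDefinite

variable {X : Type*}

lemma nonneg_inner_mul (g : X → SeqL2) (k : X → X → ℝ) (n : ℕ) (x : Fin n → X)
    (hk : ∀ a : Fin n → ℝ, 0 ≤ ∑ i, ∑ j, a i * k (x i) (x j) * a j) (a : Fin n → ℝ) :
    0 ≤ ∑ i, ∑ j, a i * (⟪g (x i), g (x j)⟫_ℝ * k (x i) (x j)) * a j := by
  have h0 : ∀ u v : SeqL2, HasSum (fun m : ℕ => u m * v m) ⟪u, v⟫_ℝ := fun u v => by
    refine (lp.hasSum_inner (𝕜 := ℝ) u v).congr_fun fun m => ?_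
    simp [mul_comm]
  have h : HasSum (fun m : ℕ => ∑ i, ∑ j,
      a i * ((g (x i) m * g (x j) m) * k (x i) (x j)) * a j)
      (∑ i, ∑ j, a i * (⟪g (x i), g (x j)⟫_ℝ * k (x i) (x j)) * a j) :=
    hasSum_sum fun i _ => hasSum_sum fun j _ =>
      (((h0 (g (x i)) (g (x j))).mul_right _).mul_left _).mul_right _
  refine h.nonneg fun m => ?_
  refine (hk fun i => a i * g (x i) m).trans_eq ?_
  refine Finset.sum_congr rfl fun i _ => Finset.sum_congr rfl fun j _ => ?_
  ring

lemma nonneg_inner_pow (g : X → SeqL2) (n : ℕ) (x : Fin n → X) (m : ℕ) (a : Fin n → ℝ) :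
    0 ≤ ∑ i, ∑ j, a i * ⟪g (x i), g (x j)⟫_ℝ ^ m * a j := by
  induction m generalizing a with
  | zero =>
    have : ∑ i, ∑ j, a i * ⟪g (x i), g (x j)⟫_ℝ ^ 0 * a j = (∑ i, a i) * ∑ j, a j := by
      simp [Finset.sum_mul_sum]
    rw [this]
    exact mul_self_nonneg _
  | succ m ih =>
    have := nonneg_inner_mul g (fun u v => ⟪g u, g v⟫_ℝ ^ m) n x ih a
    simpa only [pow_succ'] using this

lemma nonneg_power_series (g : X → SeqL2) (c : ℕ → ℝ) (hc : ∀ n, 0 ≤ c n)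
    (hs : ∀ x y, Summable fun m => c m * ⟪g x, g y⟫_ℝ ^ m)
    (n : ℕ) (x : Fin n → X) (a : Fin n → ℝ) :
    0 ≤ ∑ i, ∑ j, a i * (∑' m, c m * ⟪g (x i), g (x j)⟫_ℝ ^ m) * a j := by
  have h : HasSum (fun m : ℕ => ∑ i, ∑ j, a i * (c m * ⟪g (x i), g (x j)⟫_ℝ ^ m) * a j)
      (∑ i, ∑ j, a i * (∑' m, c m * ⟪g (x i), g (x j)⟫_ℝ ^ m) * a j) :=
    hasSum_sum fun i _ => hasSum_sum fun j _ => ((hs _ _).hasSum.mul_left _).mul_right _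
  refine h.nonneg fun m => ?_
  have := mul_nonneg (hc m) (nonneg_inner_pow g n x m a)
  refine this.trans_eq ?_
  simp only [Finset.mul_sum]
  refine Finset.sum_congr rfl fun i _ => Finset.sum_congr rfl fun j _ => ?_
  ring

lemma nonneg_gaussian (g : X → SeqL2) (s : ℝ) (hs : 0 ≤ s)
    (n : ℕ) (x : Fin n → X) (a : Fin n → ℝ) :
    0 ≤ ∑ i, ∑ j, a i * Real.exp (-(s * ‖g (x i) - g (x j)‖ ^ 2)) * a j := by
  have h := nonneg_power_series g (fun m => (2 * s) ^ m / (m.factorial : ℝ))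
    (fun m => by positivity)
    (fun u v => by
      refine (Real.summable_pow_div_factorial (2 * s * ⟪g u, g v⟫_ℝ)).congr fun m => ?_
      rw [mul_pow]; ring)
    n x (fun i => a i * Real.exp (-(s * ‖g (x i)‖ ^ 2)))
  refine h.trans_eq (Finset.sum_congr rfl fun i _ => Finset.sum_congr rfl fun j _ => ?_)
  have e : (∑' m : ℕ, (2 * s) ^ m / (m.factorial : ℝ) * ⟪g (x i), g (x j)⟫_ℝ ^ m)
      = Real.exp (2 * s * ⟪g (x i), g (x j)⟫_ℝ) := by
    rw [Real.exp_eq_exp_ℝ, NormedSpace.exp_eq_tsum_div]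
    refine tsum_congr fun m => ?_
    rw [mul_pow (2 * s)]; ring
  rw [e, norm_sub_sq_real]
  have : Real.exp (-(s * (‖g (x i)‖ ^ 2 - 2 * ⟪g (x i), g (x j)⟫_ℝ + ‖g (x j)‖ ^ 2)))
      = Real.exp (-(s * ‖g (x i)‖ ^ 2)) * Real.exp (2 * s * ⟪g (x i), g (x j)⟫_ℝ)
        * Real.exp (-(s * ‖g (x j)‖ ^ 2)) := by
    rw [← Real.exp_add, ← Real.exp_add]
    congr 1
    ring
  rw [this]
  ring

lemma integrable_exp_neg (μ : Measure ℝ≥0) [IsFiniteMeasure μ] (t : ℝ) (ht : 0 ≤ t) :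
    Integrable (fun s : ℝ≥0 => Real.exp (-((s : ℝ) * t))) μ := by
  refine Integrable.of_bound (C := 1) (by fun_prop) (Filter.Eventually.of_forall fun s => ?_)
  rw [Real.norm_eq_abs, abs_of_pos (Real.exp_pos _), Real.exp_le_one_iff]
  have : 0 ≤ (s : ℝ) * t := mul_nonneg s.2 ht
  linarith

lemma nonneg_radial (μ : Measure ℝ≥0) [IsFiniteMeasure μ] (g : X → SeqL2)
    (n : ℕ) (x : Fin n → X) (a : Fin n → ℝ) :
    0 ≤ ∑ i, ∑ j, a i * (∫ s : ℝ≥0, Real.exp (-((s : ℝ) * ‖g (x i) - g (x j)‖ ^ 2)) ∂μ) * a j := by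
  have hint : ∀ i j, Integrable (fun s : ℝ≥0 =>
      a i * Real.exp (-((s : ℝ) * ‖g (x i) - g (x j)‖ ^ 2)) * a j) μ := fun i j =>
    ((integrable_exp_neg μ _ (sq_nonneg _)).const_mul _).mul_const _
  have h : 0 ≤ ∫ s : ℝ≥0, ∑ i, ∑ j,
      a i * Real.exp (-((s : ℝ) * ‖g (x i) - g (x j)‖ ^ 2)) * a j ∂μ :=
    integral_nonneg fun s => nonneg_gaussian g s s.2 n x a
  rw [integral_finsetSum _ fun i _ => integrable_finsetSum _ fun j _ => hint i j] at h
  refine h.trans_eq (Finset.sum_congr rfl fun i _ => ?_)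
  rw [integral_finsetSum _ fun j _ => hint i j]
  refine Finset.sum_congr rfl fun j _ => ?_
  rw [integral_mul_const, integral_const_mul]

end PositiveDefinite

/-- The data of a Taylor kernel (positive coefficients `a n` whose power series converges absolutely
on `[-4 D ^ 2, 4 D ^ 2]`) or of a radial kernel (a finite Borel measure on `[0, ∞)`, non-zero and
with support different from `{0}`). -/
inductive TaylorOrRadial (D : ℝ)
  | taylor (a : ℕ → ℝ) (a_pos : ∀ n, 0 < a n)
      (conv : ∀ t ∈ Icc (-(4 * D ^ 2)) (4 * D ^ 2), Summable fun n => |a n * t ^ n|) :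
      TaylorOrRadial D
  | radial (μ : Measure ℝ≥0) (finite : IsFiniteMeasure μ) (ne_zero : μ ≠ 0)
      (supp : μ.support ≠ {0}) : TaylorOrRadial D

namespace TaylorOrRadial

variable {D : ℝ}

/-- The scalar function `K`: `K t = ∑ a n * t ^ n`, respectively `K t = ∫ exp (- s t) dμ(s)`. -/
def K : TaylorOrRadial D → ℝ → ℝ
  | taylor a _ _ => fun t => ∑' n, a n * t ^ n
  | radial μ _ _ _ => fun t => ∫ s : ℝ≥0, Real.exp (-((s : ℝ) * t)) ∂μ

/-- The interval over which the maximum of `|K'|` is taken. -/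
def interval : TaylorOrRadial D → Set ℝ
  | taylor _ _ _ => Icc (-(4 * D ^ 2)) (4 * D ^ 2)
  | radial _ _ _ _ => Icc 0 (4 * D ^ 2)

/-- `K` is differentiable on the interval (one-sidedly at its ends) and `C` is the maximum
of `|K'|` there. -/
def IsMaxAbsDeriv (P : TaylorOrRadial D) (C : ℝ) : Prop :=
  DifferentiableOn ℝ P.K P.interval ∧
    IsGreatest ((fun t => |derivWithin P.K P.interval t|) '' P.interval) C

/-- The error constant. -/
def rho (P : TaylorOrRadial D) (η C : ℝ) : ℝ :=
  match P with
  | taylor _ _ _ => η ^ (1 / 2 : ℝ) * √(2 * D * C)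
  | radial _ _ _ _ => η * √(2 * C)

/-- The Taylor kernel `K ⟪u, v⟫`, respectively the radial kernel `K (‖u - v‖ ^ 2)`, on a subset
`W` of the closed ball of radius `D`. -/
def kernelOn (P : TaylorOrRadial D) (W : Set SeqL2) (hW : ∀ w ∈ W, ‖w‖ ≤ D) : PDKernel W :=
  match P with
  | taylor a a_pos conv =>
    { toFun := fun u v => (taylor a a_pos conv).K ⟪(u : SeqL2), (v : SeqL2)⟫_ℝ
      symm := fun u v => by rw [real_inner_comm]
      nonneg := fun n x c => nonneg_power_series (fun w : W => (w : SeqL2)) a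
        (fun n => (a_pos n).le) (fun u v => (conv _ (by
          have h1 := abs_real_inner_le_norm (u : SeqL2) (v : SeqL2)
          have h2 : ‖(u : SeqL2)‖ * ‖(v : SeqL2)‖ ≤ D * D :=
            mul_le_mul (hW u u.2) (hW v v.2) (norm_nonneg _) ((norm_nonneg _).trans (hW u u.2))
          rw [mem_Icc, ← abs_le]
          nlinarith [sq_nonneg D])).of_abs) n x c }
  | radial μ finite ne_zero supp =>
    { toFun := fun u v => (radial (D := D) μ finite ne_zero supp).K (‖(u : SeqL2) - (v : SeqL2)‖ ^ 2)
      symm := fun u v => by rw [norm_sub_rev]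
      nonneg := fun n x c => nonneg_radial μ (fun w : W => (w : SeqL2)) n x c }

end TaylorOrRadial

lemma summable_sq_div_pow {q : ℝ} (hq : 1 < q) (c M : ℝ) (d : ℕ → ℝ) (hd : ∀ n, |d n| ≤ M) :
    Summable fun n => (c * d n / q ^ n) ^ 2 := by
  have hg : Summable fun n : ℕ => (c ^ 2 * M ^ 2) * ((q ^ 2)⁻¹) ^ n :=
    (summable_geometric_of_lt_one (by positivity)
      (inv_lt_one_of_one_lt₀ (one_lt_pow₀ hq two_ne_zero))).mul_left _
  refine Summable.of_nonneg_of_le (fun n => sq_nonneg _) (fun n => ?_) hg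
  have h1 : d n ^ 2 ≤ M ^ 2 := sq_le_sq' (abs_le.1 (hd n)).1 (abs_le.1 (hd n)).2
  have h2 : (c * d n / q ^ n) ^ 2 = c ^ 2 * d n ^ 2 * ((q ^ 2)⁻¹) ^ n := by
    rw [div_pow, mul_pow, inv_pow, ← pow_mul, ← pow_mul, mul_comm n 2]
    rfl
  rw [h2]
  have : 0 < q := by linarith
  gcongr

lemma memlp_div_pow {q : ℝ} (hq : 1 < q) (c M : ℝ) (d : ℕ → ℝ) (hd : ∀ n, |d n| ≤ M) :
    Memℓp (fun n => c * d n / q ^ n) 2 := by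
  refine memℓp_gen ?_
  refine (summable_sq_div_pow hq c M d hd).congr fun n => ?_
  rw [ENNReal.toReal_ofNat, Real.norm_eq_abs, Real.rpow_ofNat, sq_abs]

section Embeddings

variable {X : Type*} [MetricSpace X] [CompactSpace X] {J : ℕ}

/-- The map `φ : X → ℓ²`, `φ(x) n = c_φ * d(x, x_n) / q ^ n`, `c_φ = √(q ^ 2 - 1) / q`. -/
def phi (q : ℝ) (hq : 1 < q) (x : ℕ → X) (z : X) : SeqL2 :=
  ⟨fun n => (√(q ^ 2 - 1) / q) * dist z (x n) / q ^ n,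
    memlp_div_pow hq _ (Metric.diam (univ : Set X)) _ fun n => by
      rw [abs_of_nonneg dist_nonneg]
      exact Metric.dist_le_diam_of_mem isCompact_univ.isBounded trivial trivial⟩

/-- The map from `X` to Euclidean space sending `z` to the vector of the `d(z, y_j) / √J`. -/
def hatPhi (y : Fin J → X) (z : X) : EuclideanSpace ℝ (Fin J) :=
  WithLp.toLp 2 fun j => dist z (y j) / √J

/-- The map `B` from Euclidean space to `ℓ²`, `B(u) n = c_B * u_{β(n)} / q ^ n`,
`c_B = √(J (q ^ 2 - 1)) / q`. -/
def mapB (q : ℝ) (hq : 1 < q) (β : ℕ → Fin J) (u : EuclideanSpace ℝ (Fin J)) : SeqL2 :=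
  ⟨fun n => (√(J * (q ^ 2 - 1)) / q) * u (β n) / q ^ n,
    memlp_div_pow hq _ ‖u‖ _ fun n => by
      simpa using PiLp.norm_apply_le u (β n)⟩

/-- The set `W = φ(X) ∪ B(hatPhi(X))`. -/
def setW (q : ℝ) (hq : 1 < q) (y : Fin J → X) (x : ℕ → X) (β : ℕ → Fin J) : Set SeqL2 :=
  range (phi q hq x) ∪ range (fun z => mapB q hq β (hatPhi y z))

lemma norm_le_of_coord {q : ℝ} (hq : 1 < q) {M : ℝ} (w : SeqL2) (d : ℕ → ℝ)
    (hd : ∀ n, |d n| ≤ M) (hw : ∀ n, w n = (√(q ^ 2 - 1) / q) * d n / q ^ n) : ‖w‖ ≤ M := by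
  have hM : 0 ≤ M := (abs_nonneg _).trans (hd 0)
  have hq0 : 0 < q := by linarith
  have hq2 : 1 < q ^ 2 := one_lt_pow₀ hq two_ne_zero
  have hsum : HasSum (fun n : ℕ => ((q ^ 2 - 1) / q ^ 2 * M ^ 2) * ((q ^ 2)⁻¹) ^ n) (M ^ 2) := by
    have := (hasSum_geometric_of_lt_one (r := (q ^ 2)⁻¹) (by positivity)
      (inv_lt_one_of_one_lt₀ hq2)).mul_left ((q ^ 2 - 1) / q ^ 2 * M ^ 2)
    have h1 : q ^ 2 - 1 ≠ 0 := by linarith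
    have h2 : q ^ 2 ≠ 0 := by positivity
    have h3 : 1 - (q ^ 2)⁻¹ = (q ^ 2 - 1) / q ^ 2 := by
      rw [sub_div, div_self h2, one_div]
    have h4 : (q ^ 2 - 1) / q ^ 2 * M ^ 2 * (1 - (q ^ 2)⁻¹)⁻¹ = M ^ 2 := by
      rw [h3, mul_comm, ← mul_assoc, inv_mul_cancel₀ (div_ne_zero h1 h2), one_mul]
    rw [h4] at this
    exact this
  have hw2 : HasSum (fun n => ⟪w n, w n⟫_ℝ) ⟪w, w⟫_ℝ := lp.hasSum_inner w w
  rw [real_inner_self_eq_norm_sq] at hw2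
  have : ‖w‖ ^ 2 ≤ M ^ 2 := by
    refine hasSum_le (fun n => ?_) hw2 hsum
    have h1 : d n ^ 2 ≤ M ^ 2 := sq_le_sq' (abs_le.1 (hd n)).1 (abs_le.1 (hd n)).2
    have h2 : ⟪w n, w n⟫_ℝ = ((q ^ 2 - 1) / q ^ 2 * d n ^ 2) * ((q ^ 2)⁻¹) ^ n := by
      rw [real_inner_self_eq_norm_sq, Real.norm_eq_abs, sq_abs, hw n, div_pow, mul_pow, div_pow,
        Real.sq_sqrt (by linarith), inv_pow, ← pow_mul, ← pow_mul, mul_comm n 2]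
      rfl
    rw [h2]
    have : 0 < q ^ 2 - 1 := by linarith
    gcongr
  exact (sq_le_sq₀ (norm_nonneg _) hM).1 this

lemma norm_le_of_mem_setW (q : ℝ) (hq : 1 < q) (y : Fin J → X) (x : ℕ → X) (β : ℕ → Fin J) :
    ∀ w ∈ setW q hq y x β, ‖w‖ ≤ Metric.diam (univ : Set X) := by
  have hdist : ∀ a b : X, |dist a b| ≤ Metric.diam (univ : Set X) := fun a b => by
    rw [abs_of_nonneg dist_nonneg]
    exact Metric.dist_le_diam_of_mem isCompact_univ.isBounded trivial trivial
  rintro w (⟨z, rfl⟩ | ⟨z, rfl⟩)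
  · exact norm_le_of_coord hq _ (fun n => dist z (x n)) (fun n => hdist _ _) fun n => rfl
  · refine norm_le_of_coord hq _ (fun n => dist z (y (β n))) (fun n => hdist _ _) fun n => ?_
    have hJ : (0 : ℝ) < J := by exact_mod_cast (Fin.pos (β 0))
    have hJ' : √(J : ℝ) ≠ 0 := (Real.sqrt_pos.2 hJ).ne'
    change (√(J * (q ^ 2 - 1)) / q) * (dist z (y (β n)) / √J) / q ^ n =
      (√(q ^ 2 - 1) / q) * dist z (y (β n)) / q ^ n
    have e : √((J : ℝ) * (q ^ 2 - 1)) / q * (dist z (y (β n)) / √J) =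
        (√(J : ℝ) / √J) * (√(q ^ 2 - 1) / q * dist z (y (β n))) := by
      rw [Real.sqrt_mul hJ.le]
      ring
    rw [e, div_self hJ', one_mul]

/-- `φ` as a map into `W`. -/
def phiW (q : ℝ) (hq : 1 < q) (y : Fin J → X) (x : ℕ → X) (β : ℕ → Fin J) (z : X) :
    setW q hq y x β :=
  ⟨phi q hq x z, Or.inl ⟨z, rfl⟩⟩

/-- `B ∘ hatPhi` as a map into `W`. -/
def hatPhiW (q : ℝ) (hq : 1 < q) (y : Fin J → X) (x : ℕ → X) (β : ℕ → Fin J) (z : X) :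
    setW q hq y x β :=
  ⟨mapB q hq β (hatPhi y z), Or.inr ⟨z, rfl⟩⟩

/-- The sequence `x` is dense in `X` and, with the assignment `β`, is adapted to the centres `y` and
the scale `q`: the point `y (β n)` is a closest centre to `x n`, each centre is used infinitely
often, and `∑ 1 / q ^ (2 n)` is split evenly between the centres. -/
structure IsAdaptedBasis (y : Fin J → X) (q : ℝ) (x : ℕ → X) (β : ℕ → Fin J) : Prop where
  dense : ∀ z : X, ∀ δ > 0, ∃ n, dist z (x n) ≤ δ
  closest : ∀ n j, dist (x n) (y (β n)) ≤ dist (x n) (y j)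
  infinite : ∀ j, (β ⁻¹' {j}).Infinite
  balanced : ∀ j, ∑' n : β ⁻¹' {j}, 1 / q ^ (2 * (n : ℕ)) = 1 / (J : ℝ) * (q ^ 2 / (q ^ 2 - 1))

/-- The kernel `k_W` on `W`. -/
def kernelW (P : TaylorOrRadial (Metric.diam (univ : Set X))) (q : ℝ) (hq : 1 < q)
    (y : Fin J → X) (x : ℕ → X) (β : ℕ → Fin J) : PDKernel (setW q hq y x β) :=
  P.kernelOn (setW q hq y x β) (norm_le_of_mem_setW q hq y x β)

/-- The kernel `k(z, z') = k_W(φ(z), φ(z'))` on `X`. -/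
def kernelX (P : TaylorOrRadial (Metric.diam (univ : Set X))) (q : ℝ) (hq : 1 < q)
    (y : Fin J → X) (x : ℕ → X) (β : ℕ → Fin J) : PDKernel X :=
  (kernelW P q hq y x β).comp (phiW q hq y x β)

/-- The kernel on `X` given by `k_W(B(hatPhi(z)), B(hatPhi(z')))`. -/
def hatKernelX (P : TaylorOrRadial (Metric.diam (univ : Set X))) (q : ℝ) (hq : 1 < q)
    (y : Fin J → X) (x : ℕ → X) (β : ℕ → Fin J) : PDKernel X :=
  (kernelW P q hq y x β).comp (hatPhiW q hq y x β)

end Embeddings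

end

/-! The feasible set of the minimisation is closed and convex, so everything about the minimiser
reduces to its being non-empty, that is, to universality of `k`. By Hahn-Banach, if the span of the
sections of `k` were not uniformly dense, a non-zero continuous functional `ℓ` would annihilate all
of them, hence `(ℓ ⊗ ℓ)(k) = 0`. The kernel is a positive combination (a sum, or for radial kernels
an integral of sums) of terms `S ^ m * (w ⊗ w)`, where `S` is the Gram function of `φ` and `w` a
nowhere vanishing weight. Since `S` is itself a sum of tensor squares of the coordinates of `φ`, `(ℓ
⊗ ℓ)(k)` dominates, up to a positive factor, the square of `ℓ` at every weighted monomial in these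
coordinates (`sq_le_doubleFunctional_pow`). So `ℓ` kills all of them, and Stone-Weierstrass gives `ℓ
= 0`; the coordinates separate points because `(x_n)` is dense.

For the error bound, both kernels on `X` are pull backs of the single kernel `k_W`. An element of
`H` has the form `z ↦ ⟪F, k_W(·, φ z)⟫` with `‖F‖ ≤ ‖h‖`; replacing `φ z` by its surrogate `B
(hatPhi z)` gives an element of the other space (`PDKernel.exists_rkhs_comp_near`). Cauchy-Schwarz
leaves the distance between two sections of `k_W`, which the mean value inequality for `K` controls
(`norm_sec_sub_sec_le`) through the uniform bound `η` on the distance between the two embeddings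
(`norm_phi_sub_mapB_le`). -/

noncomputable section

/-! ### Feature maps, transfer between pulled back kernels, and minimal norm approximants -/

namespace PDKernel

variable {X : Type*}

/-- The section `k(·, x)` as an element of the reproducing kernel Hilbert space. -/
def sec (k : PDKernel X) (x : X) : k.rkhs := RKHS.kerFun k.rkhs x 1

lemma inner_sec (k : PDKernel X) (h : k.rkhs) (x : X) : ⟪h, k.sec x⟫_ℝ = h x := by
  simp [sec]

lemma sec_apply (k : PDKernel X) (x y : X) : k.sec x y = k.toFun y x := by
  rw [sec, RKHS.kerFun_apply, RKHS.OfKernel.kernel_ofKernel, toMatrix_apply, mul_one]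

lemma inner_sec_sec (k : PDKernel X) (x y : X) : ⟪k.sec x, k.sec y⟫_ℝ = k.toFun x y := by
  rw [inner_sec, sec_apply, k.symm]

lemma denseRange_linearCombination_sec (k : PDKernel X) :
    DenseRange (Finsupp.linearCombination ℝ k.sec) := by
  have h := RKHS.kerFun_dense (𝕜 := ℝ) k.rkhs
  have hs : Submodule.span ℝ {RKHS.kerFun k.rkhs x v | (x) (v)}
      ≤ LinearMap.range (Finsupp.linearCombination ℝ k.sec) := by
    rw [Submodule.span_le]
    rintro _ ⟨x, v, rfl⟩
    refine ⟨Finsupp.single x v, ?_⟩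
    rw [Finsupp.linearCombination_single, sec, ← map_smul, smul_eq_mul, mul_one]
  have h2 := Submodule.topologicalClosure_mono hs
  rw [h, top_le_iff] at h2
  rw [DenseRange, dense_iff_closure_eq]
  exact congrArg (fun S : Submodule ℝ k.rkhs => (S : Set k.rkhs)) h2

lemma inner_linearCombination_of_inner_eq {E F : Type*} [NormedAddCommGroup E]
    [InnerProductSpace ℝ E] [NormedAddCommGroup F] [InnerProductSpace ℝ F] {u : X → E} {v : X → F}
    (h : ∀ x y, ⟪u x, u y⟫_ℝ = ⟪v x, v y⟫_ℝ) (c d : X →₀ ℝ) :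
    ⟪Finsupp.linearCombination ℝ u c, Finsupp.linearCombination ℝ u d⟫_ℝ
      = ⟪Finsupp.linearCombination ℝ v c, Finsupp.linearCombination ℝ v d⟫_ℝ := by
  simp only [Finsupp.linearCombination_apply, Finsupp.sum_inner, Finsupp.inner_sum,
    real_inner_smul_left, real_inner_smul_right, h]

section Feature

variable {G : Type*} [NormedAddCommGroup G] [InnerProductSpace ℝ G] [CompleteSpace G]

/-- The families `k.sec` and `Ψ` have the same Gram matrix, so sending one to the other is isometric
on finite linear combinations, and these are dense in the source. -/
lemma exists_feature_map (k : PDKernel X) (Ψ : X → G) (hΨ : ∀ x y, ⟪Ψ x, Ψ y⟫_ℝ = k.toFun x y) :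
    ∃ T : k.rkhs →L[ℝ] G, (∀ h, ‖T h‖ ≤ ‖h‖) ∧ ∀ x, T (k.sec x) = Ψ x := by
  have hn : ∀ c : X →₀ ℝ, ‖Finsupp.linearCombination ℝ Ψ c‖
      ≤ 1 * ‖Finsupp.linearCombination ℝ k.sec c‖ := fun c => by
    rw [one_mul, norm_eq_sqrt_real_inner, norm_eq_sqrt_real_inner,
      inner_linearCombination_of_inner_eq (v := k.sec) fun x y => by rw [hΨ, inner_sec_sec]]
  have hd := k.denseRange_linearCombination_sec
  refine ⟨(Finsupp.linearCombination ℝ Ψ).extendOfNorm (Finsupp.linearCombination ℝ k.sec),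
    fun h => ?_, fun x => ?_⟩
  · simpa using LinearMap.norm_extendOfNorm_apply_le hd 1 hn h
  · have := LinearMap.extendOfNorm_eq hd ⟨1, hn⟩ (Finsupp.single x 1)
    simpa using this

/-- Take `F = T h` for the feature map `T`: its adjoint sends `Ψ x` back to `k.sec x`, so the
reproducing property moves across. -/
lemma exists_eq_inner (k : PDKernel X) (Ψ : X → G) (hΨ : ∀ x y, ⟪Ψ x, Ψ y⟫_ℝ = k.toFun x y)
    (h : k.rkhs) : ∃ F : G, ‖F‖ ≤ ‖h‖ ∧ ∀ x, h x = ⟪F, Ψ x⟫_ℝ := by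
  obtain ⟨T, hT, hs⟩ := k.exists_feature_map Ψ hΨ
  refine ⟨T h, hT h, fun x => ?_⟩
  have : T.adjoint (Ψ x) = k.sec x := RKHS.ext fun y => by
    rw [← inner_sec, ContinuousLinearMap.adjoint_inner_left, hs, hΨ, sec_apply, k.symm]
  rw [← ContinuousLinearMap.adjoint_inner_right, this, inner_sec]

lemma exists_rkhs_eq_inner (k : PDKernel X) (Ψ : X → G)
    (hΨ : ∀ x y, ⟪Ψ x, Ψ y⟫_ℝ = k.toFun x y) (F : G) :
    ∃ h : k.rkhs, ∀ x, h x = ⟪F, Ψ x⟫_ℝ := by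
  obtain ⟨T, -, hs⟩ := k.exists_feature_map Ψ hΨ
  refine ⟨T.adjoint F, fun x => ?_⟩
  rw [← inner_sec, ContinuousLinearMap.adjoint_inner_left, hs]

end Feature

lemma norm_sub_sec_sq (k : PDKernel X) (x y : X) :
    ‖k.sec x - k.sec y‖ ^ 2 = k.toFun x x - 2 * k.toFun x y + k.toFun y y := by
  rw [norm_sub_sq_real, ← real_inner_self_eq_norm_sq, ← real_inner_self_eq_norm_sq,
    inner_sec_sec, inner_sec_sec, inner_sec_sec]

/-- An element of the space of a pulled back kernel is transferred along a second pull back of the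
same kernel, with an error governed by the distance of the kernel sections. -/
lemma exists_rkhs_comp_near {Y : Type*} (k : PDKernel Y) (g g' : X → Y) (ρ : ℝ)
    (hρ : ∀ x, ‖k.sec (g x) - k.sec (g' x)‖ ≤ ρ) (h : (k.comp g).rkhs) :
    ∃ h' : (k.comp g').rkhs, ∀ x, |h x - h' x| ≤ ρ * ‖h‖ := by
  obtain ⟨F, hF, hhF⟩ := (k.comp g).exists_eq_inner (fun x => k.sec (g x))
    (fun x y => k.inner_sec_sec _ _) h
  obtain ⟨h', hh'⟩ := (k.comp g').exists_rkhs_eq_inner (fun x => k.sec (g' x))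
    (fun x y => k.inner_sec_sec _ _) F
  refine ⟨h', fun x => ?_⟩
  rw [hhF, hh', ← inner_sub_right, mul_comm]
  exact (abs_real_inner_le_norm _ _).trans (mul_le_mul hF (hρ x) (norm_nonneg _) (norm_nonneg _))

/-- The minimiser is the projection of `0` onto the feasible set, which is closed and convex because
point evaluations are continuous and linear. -/
lemma exists_unique_isMinNormApprox (k : PDKernel X) (f : X → ℝ) (ε : ℝ)
    (hne : ∃ h : k.rkhs, ∀ x, |h x - f x| ≤ ε) :
    ∃ h : k.rkhs, k.IsMinNormApprox f ε h ∧ ∀ h', k.IsMinNormApprox f ε h' → h' = h := by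
  set S : Set k.rkhs := {g : k.rkhs | ∀ x, |g x - f x| ≤ ε} with hS
  have hSi : S = ⋂ x, (RKHS.coeCLM ℝ : k.rkhs →L[ℝ] X → ℝ) ⁻¹'
      ((fun φ : X → ℝ => φ x) ⁻¹' Metric.closedBall (f x) ε) := by
    ext g
    simp [hS, Real.dist_eq]
  have hclosed : IsClosed S := by
    rw [hSi]
    exact isClosed_iInter fun x => (Metric.isClosed_closedBall.preimage
      (continuous_apply x)).preimage (ContinuousLinearMap.continuous _)
  have hconv : Convex ℝ S := by
    rw [hSi]
    exact convex_iInter fun x => ((convex_closedBall (f x) ε).linear_preimage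
      (LinearMap.proj (R := ℝ) (φ := fun _ : X => ℝ) x)).linear_preimage
        (RKHS.coeCLM ℝ : k.rkhs →L[ℝ] X → ℝ).toLinearMap
  obtain ⟨h, hhS, hh⟩ := exists_norm_eq_iInf_of_complete_convex (K := S) hne
    hclosed.isComplete hconv 0
  have hle : ∀ g ∈ S, ‖h‖ ≤ ‖g‖ := fun g hg => by
    rw [zero_sub, norm_neg] at hh
    rw [hh]
    refine (ciInf_le ⟨0, ?_⟩ (⟨g, hg⟩ : S)).trans_eq (by simp)
    rintro _ ⟨w, rfl⟩
    exact norm_nonneg _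
  have hvar := (norm_eq_iInf_iff_real_inner_le_zero hconv hhS).1 hh
  refine ⟨h, ⟨fun g hg => ?_, hhS⟩, fun h' hh' => ?_⟩
  · exact pow_le_pow_left₀ (norm_nonneg _) (hle g hg) 2
  -- The variational inequality gives `‖h‖² ≤ ⟪h, h'⟫`; together with `‖h'‖ ≤ ‖h‖`, expanding `‖h' -
  -- h‖²` gives a non-positive number.
  · have h1 : ‖h'‖ ^ 2 ≤ ‖h‖ ^ 2 := hh'.1 hhS
    have h2 := hvar h' hh'.2
    rw [zero_sub, inner_neg_left, inner_sub_right, real_inner_self_eq_norm_sq] at h2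
    have h3 := norm_sub_sq_real h' h
    rw [real_inner_comm] at h3
    have h4 : ‖h' - h‖ ^ 2 = 0 := le_antisymm (by linarith) (sq_nonneg _)
    exact sub_eq_zero.1 (norm_eq_zero.1 (pow_eq_zero_iff two_ne_zero |>.1 h4))

end PDKernel

/-! ### Universality through the functional `ℓ ⊗ ℓ` -/

section DoubleFunctional

/-- The external product `(x, y) ↦ f x * f y`. -/
def tensorSq {X : Type*} [TopologicalSpace X] (f : C(X, ℝ)) : C(X × X, ℝ) :=
  f.comp ContinuousMap.fst * f.comp ContinuousMap.snd

@[simp]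
lemma tensorSq_apply {X : Type*} [TopologicalSpace X] (f : C(X, ℝ)) (p : X × X) :
    tensorSq f p = f p.1 * f p.2 := rfl

lemma tensorSq_mul {X : Type*} [TopologicalSpace X] (f g : C(X, ℝ)) :
    tensorSq (f * g) = tensorSq f * tensorSq g := by
  ext p
  simp only [tensorSq_apply, ContinuousMap.mul_apply]
  ring

variable {X : Type*} [TopologicalSpace X] [CompactSpace X]

lemma norm_tensorSq_le (f : C(X, ℝ)) : ‖tensorSq f‖ ≤ ‖f‖ ^ 2 := by
  refine (ContinuousMap.norm_le _ (sq_nonneg _)).2 fun p => ?_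
  rw [tensorSq_apply, norm_mul, sq]
  exact mul_le_mul (f.norm_coe_le_norm _) (f.norm_coe_le_norm _) (norm_nonneg _) (norm_nonneg _)

/-- The functional `ℓ` applied in the second variable. -/
def partialFunctional (ℓ : StrongDual ℝ C(X, ℝ)) (F : C(X × X, ℝ)) : C(X, ℝ) :=
  (ContinuousMap.mk ℓ ℓ.continuous).comp F.curry

/-- The functional `ℓ` applied in both variables. -/
def doubleFunctional (ℓ : StrongDual ℝ C(X, ℝ)) : C(X × X, ℝ) →L[ℝ] ℝ :=
  LinearMap.mkContinuous
    { toFun := fun F => ℓ (partialFunctional ℓ F)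
      map_add' := fun F G => by
        rw [← map_add]
        congr 1
        ext x
        rw [ContinuousMap.add_apply]
        change ℓ _ = ℓ _ + ℓ _
        rw [← map_add]
        rfl
      map_smul' := fun c F => by
        rw [RingHom.id_apply, ← map_smul]
        congr 1
        ext x
        rw [ContinuousMap.smul_apply]
        change ℓ _ = c • ℓ _
        rw [← map_smul]
        rfl }
    (‖ℓ‖ * ‖ℓ‖) fun F => by
      change ‖ℓ (partialFunctional ℓ F)‖ ≤ _
      refine (ℓ.le_opNorm _).trans ?_
      rw [mul_assoc]
      refine mul_le_mul_of_nonneg_left ?_ (norm_nonneg _)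
      refine (ContinuousMap.norm_le _ (by positivity)).2 fun x => ?_
      refine (ℓ.le_opNorm _).trans (mul_le_mul_of_nonneg_left ?_ (norm_nonneg _))
      exact (ContinuousMap.norm_le _ (norm_nonneg _)).2 fun y => F.norm_coe_le_norm (x, y)

lemma doubleFunctional_apply (ℓ : StrongDual ℝ C(X, ℝ)) (F : C(X × X, ℝ)) :
    doubleFunctional ℓ F = ℓ (partialFunctional ℓ F) := rfl

lemma doubleFunctional_tensorSq (ℓ : StrongDual ℝ C(X, ℝ)) (f : C(X, ℝ)) :
    doubleFunctional ℓ (tensorSq f) = ℓ f ^ 2 := by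
  have : partialFunctional ℓ (tensorSq f) = ℓ f • f := by
    ext x
    have h : (tensorSq f).curry x = f x • f := rfl
    change ℓ ((tensorSq f).curry x) = _
    rw [h, map_smul, ContinuousMap.smul_apply, smul_eq_mul, smul_eq_mul,
      mul_comm]
  rw [doubleFunctional_apply, this, map_smul, smul_eq_mul, sq]

/-- One factor `S` expands as `S ^ (m + 1) * (g ⊗ g) = ∑ j, S ^ m * (g Φ_j ⊗ g Φ_j)`. By induction
every term has non-negative pairing, so the sum dominates the single term whose index is the head of
the word. -/
lemma sq_le_doubleFunctional_pow {Φ : ℕ → C(X, ℝ)} {S : C(X × X, ℝ)}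
    (hS : HasSum (fun i => tensorSq (Φ i)) S) (ℓ : StrongDual ℝ C(X, ℝ)) (m : ℕ) :
    ∀ (g : C(X, ℝ)) (l : List ℕ), l.length = m →
      ℓ (g * (l.map Φ).prod) ^ 2 ≤ doubleFunctional ℓ (S ^ m * tensorSq g) := by
  induction m with
  | zero =>
    intro g l hl
    rw [List.length_eq_zero_iff.1 hl, pow_zero, one_mul, doubleFunctional_tensorSq]
    simp
  | succ m ih =>
    intro g l hl
    obtain ⟨i, l, rfl⟩ := List.exists_cons_of_length_eq_add_one hl
    have hsum : HasSum (fun j => doubleFunctional ℓ (S ^ m * tensorSq (g * Φ j)))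
        (doubleFunctional ℓ (S ^ (m + 1) * tensorSq g)) := by
      have h1 := ((hS.mul_left (S ^ m)).mul_right (tensorSq g)).mapL (doubleFunctional ℓ)
      rw [← pow_succ] at h1
      refine h1.congr_fun fun j => ?_
      rw [tensorSq_mul, mul_assoc, mul_comm (tensorSq g)]
    have h2 := ih (g * Φ i) l (by simpa using hl)
    rw [List.map_cons, List.prod_cons, ← mul_assoc]
    refine h2.trans (le_hasSum hsum i fun j _ => ?_)
    -- Only non-negativity is wanted here, so any word of length `m` serves; the constant word `0`
    -- is chosen.
    exact (sq_nonneg _).trans (ih (g * Φ j) (List.replicate m 0) (by simp))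

/-- Monomials span the algebra generated by the `Φ i`, which is dense by Stone-Weierstrass; the
weight is harmless since every `f` is `w * (w' * f)`. -/
lemma functional_eq_zero_of_monomials {Φ : ℕ → C(X, ℝ)}
    (hsep : (Algebra.adjoin ℝ (range Φ)).SeparatesPoints) (w w' : C(X, ℝ)) (hw : w * w' = 1)
    (ℓ : StrongDual ℝ C(X, ℝ)) (h : ∀ l : List ℕ, ℓ (w * (l.map Φ).prod) = 0) : ℓ = 0 := by
  have hcont : Continuous fun f : C(X, ℝ) => ℓ (w * f) :=
    ℓ.continuous.comp (continuous_const.mul continuous_id)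
  have hadj : ∀ f ∈ Algebra.adjoin ℝ (range Φ), ℓ (w * f) = 0 := fun f hf => by
    rw [← Subalgebra.mem_toSubmodule, Algebra.adjoin_eq_span] at hf
    induction hf using Submodule.span_induction with
    | mem f hf =>
      obtain ⟨L, hL, rfl⟩ := Submonoid.exists_list_of_mem_closure hf
      obtain ⟨l, rfl⟩ : L ∈ range (List.map Φ) := by
        rw [Set.range_list_map]
        exact hL
      exact h l
    | zero => rw [mul_zero, map_zero]
    | add f g _ _ hf hg => rw [mul_add, map_add, hf, hg, add_zero]
    | smul c f _ hf => rw [mul_smul_comm, map_smul, hf, smul_zero]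
  have hall : ∀ f : C(X, ℝ), ℓ (w * f) = 0 := fun f => by
    have hf := ContinuousMap.continuousMap_mem_subalgebra_closure_of_separatesPoints _ hsep f
    exact closure_minimal (t := {f : C(X, ℝ) | ℓ (w * f) = 0}) hadj
      (isClosed_eq hcont continuous_const) hf
  ext f
  have := hall (w' * f)
  rwa [← mul_assoc, hw, one_mul] at this

/-- The pairing with a weighted power series in `S` detects all monomials. -/
lemma functional_eq_zero_of_powerSeries {Φ : ℕ → C(X, ℝ)}
    (hsep : (Algebra.adjoin ℝ (range Φ)).SeparatesPoints) {S K : C(X × X, ℝ)}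
    (hS : HasSum (fun i => tensorSq (Φ i)) S) (w w' : C(X, ℝ)) (hw : w * w' = 1)
    (a : ℕ → ℝ) (ha : ∀ m, 0 < a m) (hK : HasSum (fun m => a m • (S ^ m * tensorSq w)) K)
    (ℓ : StrongDual ℝ C(X, ℝ)) (h0 : doubleFunctional ℓ K = 0) : ℓ = 0 := by
  refine functional_eq_zero_of_monomials hsep w w' hw ℓ fun l => ?_
  have hnn : ∀ m, 0 ≤ doubleFunctional ℓ (S ^ m * tensorSq w) := fun m =>
    (sq_nonneg _).trans
      (sq_le_doubleFunctional_pow hS ℓ m w (List.replicate m 0) (by simp))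
  -- A vanishing sum of non-negative terms vanishes termwise, and positivity of `a m` strips the
  -- coefficient.
  have h1 := hK.mapL (doubleFunctional ℓ)
  rw [h0, hasSum_zero_iff_of_nonneg fun m => by
    rw [map_smul, smul_eq_mul]
    exact mul_nonneg (ha m).le (hnn m)] at h1
  have h2 := congrFun h1 l.length
  rw [map_smul, smul_eq_mul, Pi.zero_apply, mul_eq_zero, or_iff_right (ha _).ne'] at h2
  have h3 := sq_le_doubleFunctional_pow hS ℓ _ w l rfl
  rw [h2] at h3
  exact pow_eq_zero_iff two_ne_zero |>.1 (le_antisymm h3 (sq_nonneg _))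

lemma doubleFunctional_nonneg_of_powerSeries {Φ : ℕ → C(X, ℝ)} {S K : C(X × X, ℝ)}
    (hS : HasSum (fun i => tensorSq (Φ i)) S) (w : C(X, ℝ))
    (a : ℕ → ℝ) (ha : ∀ m, 0 ≤ a m) (hK : HasSum (fun m => a m • (S ^ m * tensorSq w)) K)
    (ℓ : StrongDual ℝ C(X, ℝ)) : 0 ≤ doubleFunctional ℓ K := by
  refine (hK.mapL (doubleFunctional ℓ)).nonneg fun m => ?_
  rw [map_smul, smul_eq_mul]
  exact mul_nonneg (ha m) ((sq_nonneg _).trans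
    (sq_le_doubleFunctional_pow hS ℓ m w (List.replicate m 0) (by simp)))

lemma exists_functional_of_notMem_closure {E : Type*} [NormedAddCommGroup E] [NormedSpace ℝ E]
    (M : Submodule ℝ E) {f : E} (hf : f ∉ closure (M : Set E)) :
    ∃ ℓ : StrongDual ℝ E, ℓ ≠ 0 ∧ ∀ g ∈ M, ℓ g = 0 := by
  obtain ⟨ℓ, u, h1, h2⟩ := geometric_hahn_banach_closed_point
    (M.topologicalClosure.convex) M.isClosed_topologicalClosure hf
  have hM : ∀ g ∈ M, ℓ g < u := fun g hg => h1 g (subset_closure hg)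
  have hu : 0 < u := by simpa using hM 0 M.zero_mem
  refine ⟨ℓ, fun h => ?_, fun g hg => ?_⟩
  · rw [h] at h2
    exact (h2.trans hu).false
  · by_contra hne
    -- The multiple of `g` is scaled so that `ℓ` takes exactly the value `u`, against the strict
    -- bound on the subspace.
    have := hM ((u / ℓ g) • g) (M.smul_mem _ hg)
    rw [map_smul, smul_eq_mul, div_mul_cancel₀ _ hne] at this
    exact this.false

/-- A continuous kernel for which no non-zero functional annihilates its double pairing has a
uniformly dense reproducing kernel Hilbert space. -/
lemma PDKernel.exists_rkhs_near (k : PDKernel X) (K : C(X × X, ℝ))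
    (hK : ∀ x y, K (x, y) = k.toFun x y)
    (huniv : ∀ ℓ : StrongDual ℝ C(X, ℝ), doubleFunctional ℓ K = 0 → ℓ = 0)
    (f : C(X, ℝ)) {ε : ℝ} (hε : 0 < ε) : ∃ h : k.rkhs, ∀ x, |h x - f x| ≤ ε := by
  set M : Submodule ℝ C(X, ℝ) := Submodule.span ℝ (range K.curry) with hM
  have hf : f ∈ closure (M : Set C(X, ℝ)) := by
    by_contra hf
    obtain ⟨ℓ, hℓ, h0⟩ := exists_functional_of_notMem_closure M hf
    refine hℓ (huniv ℓ ?_)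
    -- The value of this function at `x` is `ℓ` applied to the section of `K` at `x`, a spanning
    -- element of `M`.
    have : partialFunctional ℓ K = 0 := by
      ext x
      exact h0 _ (Submodule.subset_span ⟨x, rfl⟩)
    rw [doubleFunctional_apply, this, map_zero]
  obtain ⟨g, hg, hgf⟩ := Metric.mem_closure_iff.1 hf ε hε
  have hrep : ∀ g ∈ M, ∃ h : k.rkhs, ∀ x, h x = g x := fun g hg => by
    induction hg using Submodule.span_induction with
    | mem g hg =>
      obtain ⟨x, rfl⟩ := hg
      exact ⟨k.sec x, fun y => by rw [k.sec_apply, k.symm, ← hK]; rfl⟩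
    | zero => exact ⟨0, fun x => by simp⟩
    | add g g' _ _ h h' =>
      obtain ⟨h, hh⟩ := h
      obtain ⟨h', hh'⟩ := h'
      exact ⟨h + h', fun x => by simp [hh, hh']⟩
    | smul c g _ h =>
      obtain ⟨h, hh⟩ := h
      exact ⟨c • h, fun x => by simp [hh]⟩
  obtain ⟨h, hh⟩ := hrep g hg
  refine ⟨h, fun x => ?_⟩
  rw [hh, ← Real.dist_eq, dist_comm]
  exact (ContinuousMap.dist_apply_le_dist x).trans hgf.le

end DoubleFunctional

/-! ### Gram functions, power series and Gaussian mixtures in `C(X × X, ℝ)` -/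

section GramFunction

variable {X : Type*} [TopologicalSpace X] [CompactSpace X]

lemma exists_hasSum_gram (g : X → SeqL2) (Φ : ℕ → C(X, ℝ)) (hΦ : ∀ i z, Φ i z = g z i)
    (hs : Summable fun i => ‖Φ i‖ ^ 2) :
    ∃ S : C(X × X, ℝ), HasSum (fun i => tensorSq (Φ i)) S ∧
      ∀ p, S p = ⟪g p.1, g p.2⟫_ℝ := by
  have h : Summable fun i => tensorSq (Φ i) :=
    (Summable.of_nonneg_of_le (fun i => norm_nonneg _) (fun i => norm_tensorSq_le (Φ i)) hs).of_norm
  refine ⟨_, h.hasSum, fun p => ?_⟩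
  refine (ContinuousMap.hasSum_apply h.hasSum p).unique ?_
  refine (lp.hasSum_inner (𝕜 := ℝ) (g p.1) (g p.2)).congr_fun fun i => ?_
  rw [tensorSq_apply, hΦ, hΦ]
  simp [mul_comm]

lemma exists_hasSum_powerSeries (S : C(X × X, ℝ)) (w : C(X, ℝ)) (a : ℕ → ℝ) {R : ℝ}
    (hS : ∀ p, |S p| ≤ R) (ha : Summable fun m => |a m * R ^ m|) :
    ∃ K : C(X × X, ℝ), HasSum (fun m => a m • (S ^ m * tensorSq w)) K ∧
      ∀ p, K p = (∑' m, a m * S p ^ m) * (w p.1 * w p.2) := by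
  have h : Summable fun m => a m • (S ^ m * tensorSq w) := by
    refine Summable.of_norm_bounded (ha.mul_right ‖tensorSq w‖) fun m => ?_
    refine (ContinuousMap.norm_le _ (by positivity)).2 fun p => ?_
    rw [ContinuousMap.smul_apply, ContinuousMap.mul_apply, ContinuousMap.pow_apply, smul_eq_mul,
      ← mul_assoc, norm_mul, norm_mul, norm_pow, Real.norm_eq_abs (a m), abs_mul, abs_pow]
    have hR : |S p| ≤ |R| := (hS p).trans (le_abs_self R)
    have h1 := (tensorSq w).norm_coe_le_norm p
    rw [Real.norm_eq_abs (S p)]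
    gcongr
  refine ⟨_, h.hasSum, fun p => ?_⟩
  refine (ContinuousMap.hasSum_apply h.hasSum p).unique ?_
  have hp : Summable fun m => a m * S p ^ m := by
    refine Summable.of_norm_bounded ha fun m => ?_
    rw [Real.norm_eq_abs, abs_mul, abs_mul, abs_pow, abs_pow]
    have hR : |S p| ≤ |R| := (hS p).trans (le_abs_self R)
    gcongr
  refine (hp.hasSum.mul_right (w p.1 * w p.2)).congr_fun fun m => ?_
  rw [ContinuousMap.smul_apply, ContinuousMap.mul_apply, ContinuousMap.pow_apply, smul_eq_mul,
    tensorSq_apply, mul_assoc]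

/-- The Gaussian `exp (-(s * N))`, as a continuous family of continuous functions. -/
def expFamily {Y : Type*} [TopologicalSpace Y] (N : C(Y, ℝ)) : C(ℝ≥0, C(Y, ℝ)) :=
  ContinuousMap.curry ⟨fun p : ℝ≥0 × Y => Real.exp (-((p.1 : ℝ) * N p.2)), by fun_prop⟩

lemma expFamily_apply {Y : Type*} [TopologicalSpace Y] (N : C(Y, ℝ)) (s : ℝ≥0) (p : Y) :
    expFamily N s p = Real.exp (-((s : ℝ) * N p)) := rfl

/-- Integrating in the Banach space `C(Y, ℝ)`, rather than pointwise, is what lets continuous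
functionals pass under the integral. -/
lemma integrable_expFamily {Y : Type*} [TopologicalSpace Y] [CompactSpace Y] (N : C(Y, ℝ))
    (hN : ∀ p, 0 ≤ N p) (μ : Measure ℝ≥0) [IsFiniteMeasure μ] : Integrable (expFamily N) μ := by
  refine Integrable.of_bound (C := 1) (expFamily N).continuous.aestronglyMeasurable
    (Filter.Eventually.of_forall fun s => (ContinuousMap.norm_le _ zero_le_one).2 fun p => ?_)
  rw [expFamily_apply, Real.norm_eq_abs, abs_of_pos (Real.exp_pos _), Real.exp_le_one_iff]
  exact neg_nonpos.2 (mul_nonneg s.2 (hN p))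

/-- The diagonal part of `N` factors out of the exponential as the invertible weight `w z = exp (-s
S(z, z))`, leaving the exponential series of `2 s S`. -/
lemma hasSum_expFamily (S : C(X × X, ℝ)) (N : C(X × X, ℝ))
    (hN : ∀ p, N p = S (p.1, p.1) + S (p.2, p.2) - 2 * S p) (s : ℝ≥0) :
    ∃ w w' : C(X, ℝ), w * w' = 1 ∧
      HasSum (fun m : ℕ => ((2 * s : ℝ) ^ m / m.factorial) • (S ^ m * tensorSq w))
        (expFamily N s) := by
  refine ⟨⟨fun z => Real.exp (-(s * S (z, z))), by fun_prop⟩,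
    ⟨fun z => Real.exp (s * S (z, z)), by fun_prop⟩, ?_, ?_⟩
  · ext z
    simp [← Real.exp_add]
  · obtain ⟨K, hK, hKp⟩ := exists_hasSum_powerSeries S
      ⟨fun z => Real.exp (-(s * S (z, z))), by fun_prop⟩
      (fun m => (2 * s : ℝ) ^ m / m.factorial) (R := ‖S‖) (fun p => S.norm_coe_le_norm p) (by
        refine (Real.summable_pow_div_factorial (2 * s * ‖S‖)).abs.congr fun m => ?_
        rw [mul_pow]
        ring_nf)
    convert! hK
    ext p
    have e : (∑' m : ℕ, (2 * s : ℝ) ^ m / (m.factorial : ℝ) * S p ^ m)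
        = Real.exp (2 * s * S p) := by
      rw [Real.exp_eq_exp_ℝ, NormedSpace.exp_eq_tsum_div]
      refine tsum_congr fun m => ?_
      rw [mul_pow (2 * (s : ℝ))]
      ring
    rw [hKp, e, expFamily_apply, hN]
    change _ = _ * (Real.exp (-(s * S (p.1, p.1))) * Real.exp (-(s * S (p.2, p.2))))
    rw [← Real.exp_add, ← Real.exp_add]
    congr 1
    ring

/-- Each Gaussian pairs non-negatively with `ℓ ⊗ ℓ`, so a vanishing integral forces vanishing almost
everywhere, hence by continuity on the whole support. A single `s > 0` in the support then suffices,
as its power series has positive coefficients. -/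
lemma functional_eq_zero_of_radial {Φ : ℕ → C(X, ℝ)}
    (hsep : (Algebra.adjoin ℝ (range Φ)).SeparatesPoints) {S N : C(X × X, ℝ)}
    (hS : HasSum (fun i => tensorSq (Φ i)) S)
    (hN : ∀ p, N p = S (p.1, p.1) + S (p.2, p.2) - 2 * S p) (hN0 : ∀ p, 0 ≤ N p)
    (μ : Measure ℝ≥0) [IsFiniteMeasure μ] (hμ : μ ≠ 0) (hsupp : μ.support ≠ {0})
    (ℓ : StrongDual ℝ C(X, ℝ)) (h0 : doubleFunctional ℓ (∫ s, expFamily N s ∂μ) = 0) :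
    ℓ = 0 := by
  have hint := integrable_expFamily N hN0 μ
  have hnn : ∀ s : ℝ≥0, 0 ≤ doubleFunctional ℓ (expFamily N s) := fun s => by
    obtain ⟨w, w', -, hw⟩ := hasSum_expFamily S N hN s
    exact doubleFunctional_nonneg_of_powerSeries hS w _ (fun m => by positivity) hw ℓ
  rw [← ContinuousLinearMap.integral_comp_comm _ hint,
    integral_eq_zero_iff_of_nonneg hnn ((doubleFunctional ℓ).integrable_comp hint)] at h0
  have hsub : μ.support ⊆ {s | doubleFunctional ℓ (expFamily N s) = 0} :=
    Measure.support_subset_of_isClosed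
      (isClosed_eq ((doubleFunctional ℓ).continuous.comp (expFamily N).continuous)
        continuous_const) h0
  obtain ⟨s, hs, hs0⟩ : ∃ s ∈ μ.support, s ≠ 0 := by
    by_contra! hcon
    exact hsupp (eq_singleton_iff_nonempty_unique_mem.2 ⟨Measure.nonempty_support hμ, hcon⟩)
  have hs' : (0 : ℝ) < s := NNReal.coe_pos.2 (pos_iff_ne_zero.2 hs0)
  obtain ⟨w, w', hww, hw⟩ := hasSum_expFamily S N hN s
  exact functional_eq_zero_of_powerSeries hsep hS w w' hww _ (fun m => by positivity) hw ℓ (hsub hs)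

end GramFunction

/-! ### Density of `H`, closeness of the two embeddings, and the error constant -/

section Approximation

variable {X : Type*} [MetricSpace X] [CompactSpace X] {J : ℕ}

/-- The `i`-th coordinate of `phi`, as a continuous function. -/
def phiCoord {X : Type*} [MetricSpace X] (q : ℝ) (x : ℕ → X) (i : ℕ) : C(X, ℝ) :=
  ⟨fun z => (√(q ^ 2 - 1) / q) * dist z (x i) / q ^ i, by fun_prop⟩

lemma summable_norm_phiCoord_sq {q : ℝ} (hq : 1 < q) (x : ℕ → X) :
    Summable fun i => ‖phiCoord q x i‖ ^ 2 := by
  have h := summable_sq_div_pow hq (√(q ^ 2 - 1) / q) (Metric.diam (univ : Set X))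
    (fun _ => Metric.diam (univ : Set X)) fun n => (abs_of_nonneg Metric.diam_nonneg).le
  refine Summable.of_nonneg_of_le (fun i => sq_nonneg _) (fun i => ?_) h
  have hq0 : 0 < q := by linarith
  have hd : 0 ≤ Metric.diam (univ : Set X) := Metric.diam_nonneg
  refine pow_le_pow_left₀ (norm_nonneg _) ((ContinuousMap.norm_le _ (by positivity)).2 fun z => ?_) 2
  change ‖(√(q ^ 2 - 1) / q) * dist z (x i) / q ^ i‖ ≤ _
  rw [Real.norm_eq_abs, abs_of_nonneg (by positivity)]
  have := Metric.dist_le_diam_of_mem (isCompact_univ (X := X)).isBounded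
    (mem_univ z) (mem_univ (x i))
  gcongr

lemma separatesPoints_phiCoord {X : Type*} [MetricSpace X] {q : ℝ} (hq : 1 < q) (x : ℕ → X)
    (hx : ∀ z : X, ∀ δ > 0, ∃ n, dist z (x n) ≤ δ) :
    (Algebra.adjoin ℝ (range (phiCoord q x))).SeparatesPoints := by
  intro z z' hzz
  -- If `x n` were equidistant from both points, the triangle inequality would give `dist z z' ≤ 2/3
  -- * dist z z'`.
  obtain ⟨n, hn⟩ := hx z (dist z z' / 3) (by have := dist_pos.2 hzz; positivity)
  refine ⟨phiCoord q x n, ⟨_, Algebra.subset_adjoin ⟨n, rfl⟩, rfl⟩, fun h => ?_⟩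
  have hq0 : 0 < q := by linarith
  have hc : √(q ^ 2 - 1) / q ≠ 0 :=
    (div_pos (Real.sqrt_pos.2 (by nlinarith)) hq0).ne'
  have h1 : dist z (x n) = dist z' (x n) :=
    mul_left_cancel₀ hc ((div_left_inj' (pow_pos hq0 n).ne').1 h)
  have h2 := dist_triangle_right z z' (x n)
  have h3 := dist_pos.2 hzz
  linarith

variable {y : Fin J → X} {q : ℝ} {x : ℕ → X} {β : ℕ → Fin J}

lemma norm_phi_le (hq : 1 < q) (y : Fin J → X) (β : ℕ → Fin J) (z : X) :
    ‖phi q hq x z‖ ≤ Metric.diam (univ : Set X) :=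
  norm_le_of_mem_setW q hq y x β _ (phiW q hq y x β z).2

lemma exists_rkhs_kernelX_near (hq : 1 < q) (hx : ∀ z : X, ∀ δ > 0, ∃ n, dist z (x n) ≤ δ)
    (P : TaylorOrRadial (Metric.diam (univ : Set X))) (f : C(X, ℝ)) {ε : ℝ} (hε : 0 < ε) :
    ∃ h : (kernelX P q hq y x β).rkhs, ∀ z, |h z - f z| ≤ ε := by
  have hsep := separatesPoints_phiCoord hq x hx
  obtain ⟨S, hS, hSp⟩ := exists_hasSum_gram (phi q hq x) (phiCoord q x) (fun i z => rfl)
    (summable_norm_phiCoord_sq hq x)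
  cases P with
  | taylor a a_pos conv =>
    -- Gram values are at most the squared diameter because `φ` maps into that ball; this radius
    -- lies in the convergence interval. No weight is needed here.
    obtain ⟨K, hK, hKp⟩ := exists_hasSum_powerSeries S 1 a
      (R := Metric.diam (univ : Set X) ^ 2) (fun p => by
        rw [hSp, sq]
        exact (abs_real_inner_le_norm _ _).trans (mul_le_mul (norm_phi_le hq y β _)
          (norm_phi_le hq y β _) (norm_nonneg _) Metric.diam_nonneg))
      (conv _ ⟨by nlinarith [sq_nonneg (Metric.diam (univ : Set X))],
        by nlinarith [sq_nonneg (Metric.diam (univ : Set X))]⟩)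
    refine PDKernel.exists_rkhs_near _ K (fun z z' => ?_)
      (functional_eq_zero_of_powerSeries hsep hS 1 1 (one_mul 1) a a_pos hK) f hε
    rw [hKp]
    simp only [ContinuousMap.one_apply, mul_one, hSp]
    rfl
  | radial μ finite ne_zero supp =>
    let N : C(X × X, ℝ) := ⟨fun p => S (p.1, p.1) + S (p.2, p.2) - 2 * S p, by fun_prop⟩
    have hNp : ∀ p, N p = ‖phi q hq x p.1 - phi q hq x p.2‖ ^ 2 := fun p => by
      change S (p.1, p.1) + S (p.2, p.2) - 2 * S p = _
      rw [norm_sub_sq_real, hSp, hSp, hSp, real_inner_self_eq_norm_sq, real_inner_self_eq_norm_sq]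
      ring
    have hN0 : ∀ p, 0 ≤ N p := fun p => hNp p ▸ sq_nonneg _
    refine PDKernel.exists_rkhs_near _ (∫ s, expFamily N s ∂μ) (fun z z' => ?_)
      (functional_eq_zero_of_radial hsep hS (fun p => rfl) hN0 μ ne_zero supp) f hε
    -- Evaluation at a point identifies the `C(X × X, ℝ)`-valued integral with the scalar integral
    -- defining the kernel.
    have := (ContinuousMap.evalCLM ℝ (z, z')).integral_comp_comm (integrable_expFamily N hN0 μ)
    refine this.symm.trans (integral_congr_ae (Filter.Eventually.of_forall fun s => ?_))
    change expFamily N s (z, z') = _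
    rw [expFamily_apply, hNp]
    rfl

/-- After the factors `√J` cancel, the `n`-th coordinate carries `d(z, x_n) - d(z, y_{β n})`, at
most `d(x_n, y_{β n}) ≤ η` in absolute value, and the weights have square sum one. -/
lemma norm_phi_sub_mapB_le (hq : 1 < q) {η : ℝ} (hcover : ∀ z, ∃ j, dist z (y j) ≤ η)
    (hβ : ∀ n j, dist (x n) (y (β n)) ≤ dist (x n) (y j)) (z : X) :
    ‖phi q hq x z - mapB q hq β (hatPhi y z)‖ ≤ η := by
  refine norm_le_of_coord hq _ (fun n => dist z (x n) - dist z (y (β n))) (fun n => ?_) fun n => ?_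
  · obtain ⟨j, hj⟩ := hcover (x n)
    have h1 := abs_dist_sub_le (x n) (y (β n)) z
    rw [dist_comm (x n) z, dist_comm (y (β n)) z] at h1
    exact h1.trans ((hβ n j).trans hj)
  · have hJ : (0 : ℝ) < J := by exact_mod_cast Fin.pos (β 0)
    have hJ' : √(J : ℝ) ≠ 0 := (Real.sqrt_pos.2 hJ).ne'
    change (√(q ^ 2 - 1) / q) * dist z (x n) / q ^ n -
      (√(J * (q ^ 2 - 1)) / q) * (dist z (y (β n)) / √J) / q ^ n = _
    have e : √((J : ℝ) * (q ^ 2 - 1)) / q * (dist z (y (β n)) / √J) =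
        (√(J : ℝ) / √J) * (√(q ^ 2 - 1) / q * dist z (y (β n))) := by
      rw [Real.sqrt_mul hJ.le]
      ring
    rw [e, div_self hJ']
    ring

namespace TaylorOrRadial

variable {D : ℝ}

lemma abs_K_sub_le (P : TaylorOrRadial D) {C : ℝ} (hC : P.IsMaxAbsDeriv C) {s t : ℝ}
    (hs : s ∈ P.interval) (ht : t ∈ P.interval) : |P.K s - P.K t| ≤ C * |s - t| := by
  have hconv : Convex ℝ P.interval := by
    cases P <;> exact convex_Icc _ _
  exact hconv.norm_image_sub_le_of_norm_derivWithin_le hC.1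
    (fun r hr => hC.2.2 ⟨r, hr, rfl⟩) ht hs

lemma IsMaxAbsDeriv.nonneg {P : TaylorOrRadial D} {C : ℝ} (hC : P.IsMaxAbsDeriv C) : 0 ≤ C := by
  obtain ⟨r, -, hr⟩ := hC.2.1
  exact hr ▸ abs_nonneg _

/-- The squared distance is `k(u,u) - 2 k(u,v) + k(v,v)`, a sum of two differences of values of `K`.
For Taylor kernels the arguments differ by at most `D η`, for radial ones by `‖u - v‖² ≤ η²`; hence
`η ^ (1/2)` in one constant and `η` in the other. -/
lemma norm_sec_sub_sec_le (P : TaylorOrRadial D) (W : Set SeqL2) (hW : ∀ w ∈ W, ‖w‖ ≤ D)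
    {C η : ℝ} (hC : P.IsMaxAbsDeriv C) (u v : W) (huv : ‖(u : SeqL2) - v‖ ≤ η) :
    ‖(P.kernelOn W hW).sec u - (P.kernelOn W hW).sec v‖ ≤ P.rho η C := by
  have hη : 0 ≤ η := (norm_nonneg _).trans huv
  have hD : 0 ≤ D := (norm_nonneg _).trans (hW u u.2)
  have hC0 := hC.nonneg
  have huD := hW u u.2
  have hvD := hW v v.2
  cases P with
  | taylor a a_pos conv =>
    have hmem : ∀ w w' : W, ⟪(w : SeqL2), (w' : SeqL2)⟫_ℝ ∈
        (taylor (D := D) a a_pos conv).interval := by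
      intro w w'
      have h1 := abs_real_inner_le_norm (w : SeqL2) (w' : SeqL2)
      have h2 : ‖(w : SeqL2)‖ * ‖(w' : SeqL2)‖ ≤ D * D :=
        mul_le_mul (hW w w.2) (hW w' w'.2) (norm_nonneg _) hD
      change _ ∈ Icc _ _
      rw [mem_Icc, ← abs_le]
      nlinarith [sq_nonneg D]
    have h1 := abs_K_sub_le _ hC (hmem u u) (hmem u v)
    have h2 := abs_K_sub_le _ hC (hmem v v) (hmem v u)
    have h3 : |⟪(u : SeqL2), (u : SeqL2)⟫_ℝ - ⟪(u : SeqL2), (v : SeqL2)⟫_ℝ| ≤ D * η := by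
      rw [← inner_sub_right]
      exact (abs_real_inner_le_norm _ _).trans (mul_le_mul huD huv (norm_nonneg _) hD)
    have h4 : |⟪(v : SeqL2), (v : SeqL2)⟫_ℝ - ⟪(v : SeqL2), (u : SeqL2)⟫_ℝ| ≤ D * η := by
      rw [← inner_sub_right]
      refine (abs_real_inner_le_norm _ _).trans (mul_le_mul hvD ?_ (norm_nonneg _) hD)
      rwa [norm_sub_rev]
    have h5 := (le_abs_self _).trans (h1.trans (mul_le_mul_of_nonneg_left h3 hC0))
    have h6 := (le_abs_self _).trans (h2.trans (mul_le_mul_of_nonneg_left h4 hC0))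
    have h7 := ((taylor a a_pos conv).kernelOn W hW).norm_sub_sec_sq u v
    change _ = (taylor a a_pos conv).K ⟪(u : SeqL2), (u : SeqL2)⟫_ℝ -
      2 * (taylor a a_pos conv).K ⟪(u : SeqL2), (v : SeqL2)⟫_ℝ +
      (taylor a a_pos conv).K ⟪(v : SeqL2), (v : SeqL2)⟫_ℝ at h7
    rw [real_inner_comm (u : SeqL2) (v : SeqL2)] at h6
    change _ ≤ η ^ (1 / 2 : ℝ) * √(2 * D * C)
    rw [← Real.sqrt_eq_rpow, ← Real.sqrt_mul hη]
    refine Real.le_sqrt_of_sq_le ?_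
    rw [h7]
    linarith
  | radial μ finite ne_zero supp =>
    have h0 : (0 : ℝ) ∈ (radial (D := D) μ finite ne_zero supp).interval :=
      ⟨le_rfl, by positivity⟩
    have huv2 : ‖(u : SeqL2) - v‖ ^ 2 ∈ (radial (D := D) μ finite ne_zero supp).interval := by
      have h1 : ‖(u : SeqL2) - v‖ ≤ 2 * D := (norm_sub_le _ _).trans (by linarith)
      exact ⟨sq_nonneg _, (pow_le_pow_left₀ (norm_nonneg _) h1 2).trans_eq (by ring)⟩
    -- Both diagonal values are `K 0`, so the squared distance is `2 (K 0 - K (‖u - v‖²))`.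
    have h1 := (le_abs_self _).trans (abs_K_sub_le _ hC h0 huv2)
    rw [zero_sub, abs_neg, abs_of_nonneg (sq_nonneg _)] at h1
    have h2 : ‖(u : SeqL2) - v‖ ^ 2 ≤ η ^ 2 := pow_le_pow_left₀ (norm_nonneg _) huv 2
    have h3 := h1.trans (mul_le_mul_of_nonneg_left h2 hC0)
    have h7 := ((radial (D := D) μ finite ne_zero supp).kernelOn W hW).norm_sub_sec_sq u v
    change _ = (radial (D := D) μ finite ne_zero supp).K (‖(u : SeqL2) - u‖ ^ 2) -
      2 * (radial (D := D) μ finite ne_zero supp).K (‖(u : SeqL2) - v‖ ^ 2) +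
      (radial (D := D) μ finite ne_zero supp).K (‖(v : SeqL2) - v‖ ^ 2) at h7
    rw [sub_self, sub_self, norm_zero, zero_pow two_ne_zero] at h7
    change _ ≤ η * √(2 * C)
    refine (sq_le_sq₀ (norm_nonneg _) (by positivity)).1 ?_
    rw [h7, mul_pow, Real.sq_sqrt (by positivity)]
    linarith

end TaylorOrRadial

end Approximation

end

theorem mainTheorem2 {X : Type*} [MetricSpace X] [CompactSpace X] [Nontrivial X]
    (η : ℝ) (hη : 0 < η) (hηD : η ≤ Metric.diam (Set.univ : Set X))
    {J : ℕ} (y : Fin J → X) (hy : Function.Injective y) (hcover : ∀ z, ∃ j, dist z (y j) ≤ η)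
    (q : ℝ) (hq : 1 < q) (hqJ : 2 ≤ J → q < √(1 + 1 / ((J : ℝ) - 1)))
    (x : ℕ → X) (β : ℕ → Fin J) (hx : IsAdaptedBasis y q x β)
    (P : TaylorOrRadial (Metric.diam (Set.univ : Set X)))
    (ε : ℝ) (hε : 0 < ε) (f : C(X, ℝ)) :
    ∃ h : (kernelX P q hq y x β).rkhs,
      (kernelX P q hq y x β).IsMinNormApprox f ε h ∧
      (∀ h' : (kernelX P q hq y x β).rkhs,
        (kernelX P q hq y x β).IsMinNormApprox f ε h' → h' = h) ∧
      ∀ C : ℝ, P.IsMaxAbsDeriv C →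
        ∃ g : (hatKernelX P q hq y x β).rkhs, ∀ z : X, |f z - g z| ≤ ε + P.rho η C * ‖h‖ := by
  obtain ⟨h, hh, huniq⟩ := (kernelX P q hq y x β).exists_unique_isMinNormApprox f ε
    (exists_rkhs_kernelX_near hq hx.dense P f hε)
  refine ⟨h, hh, huniq, fun C hC => ?_⟩
  obtain ⟨g, hg⟩ := (kernelW P q hq y x β).exists_rkhs_comp_near (phiW q hq y x β)
    (hatPhiW q hq y x β) (P.rho η C)
    (fun z => P.norm_sec_sub_sec_le _ _ hC _ _ (norm_phi_sub_mapB_le hq hcover hx.closest z)) h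
  refine ⟨g, fun z => (abs_sub_le (f z) (h z) (g z)).trans (add_le_add ?_ (hg z))⟩
  rw [abs_sub_comm]
  exact hh.2 z
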